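/- Identify the power set $P(\mathbb N)$ with the Cantor space $\{0,1\}^{\mathbb N}$; its subspaces are homeomorphic to sets of real numbers. Let $[\mathbb N]^\infty\subseteq P(\mathbb N)$ be the family of infinite subsets of $\mathbb N$, and identify each $a\in[\mathbb N]^\infty$ with its increasing enumeration, so that $a(n)$ is the $n$-th element of $a$. For $a,b\in[\mathbb N]^\infty$ write $a\le^* b$ if $a(n)\le b(n)$ for all but finitely many $n$. A set $X\subseteq[\mathbb N]^\infty$ is unbounded if there is no $b\in[\mathbb N]^\infty$ with $x\le^* b$ for all $x\in X$, and dominating if for every $a\in[\mathbb N]^\infty$ there is $x\in X$ with $a\le^* x$. Let $\mathfrak b$ and $\mathfrak d$ be the minimal cardinalities of an unbounded and of a dominating subset of $[\mathbb N]^\infty$, respectively. A topological space $Y$ is $\mathfrak d$-concentrated if $|Y|\ge\mathfrak d$ and there is a countable set $D\subseteq Y$ such that $|Y\setminus U|<\mathfrak d$ for every open set $U\supseteq D$. A topological space $Z$ is Menger (respectively, Hurewicz) if for every sequence $(\mathcal U_n)_{n\in\mathbb N}$ of open covers of $Z$ there are finite sets $\mathcal F_n\subseteq\mathcal U_n$ such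 that every point of $Z$ belongs to $\bigcup\mathcal F_n$ for some $n$ (respectively, for all but finitely many $n$). **Theorem.** Assume that $\mathfrak b=\mathfrak d$. 1. For every unbounded set $X\subseteq[\mathbb N]^\infty$ there is a $\mathfrak d$-concentrated set $Y\subseteq P(\mathbb N)$ such that the product space $X\times Y$ is not Menger. 2. Let $X$ be a set of real numbers such that $X\times H$ is Menger for every hereditarily Lindelöf Menger topological space $H$. Then $X\times H$ is Hurewicz for every hereditarily Lindelöf Hurewicz topological space $H$. -/

import Mathlib

open Cardinal Topology

universe u

namespace MengerProd

/-- The Cantor space `{0,1}^ℕ`, with the product topology. A point `a` is identified with the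
subset `{n | a n = true}` of `ℕ`, so this is also the power set `P(ℕ)`. -/
abbrev PN : Type := ℕ → Bool

/-- `[ℕ]^∞`, the family of infinite subsets of `ℕ`. -/
def InfSets : Set PN := {a | {n | a n = true}.Infinite}

/-- The increasing enumeration of `a ∈ [ℕ]^∞`: `enum a n` is the `n`-th element of `a`,
counting from `0`. -/
noncomputable def enum (a : PN) (n : ℕ) : ℕ := Nat.nth (fun k => a k = true) n

/-- `a ≤* b`: `a(n) ≤ b(n)` for all but finitely many `n`. -/
def LeStar (a b : PN) : Prop := {n | enum b n < enum a n}.Finite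

/-- `X ⊆ [ℕ]^∞` is bounded: it has a `≤*`-upper bound in `[ℕ]^∞`. -/
def IsBoundedStar (X : Set PN) : Prop := ∃ b ∈ InfSets, ∀ x ∈ X, LeStar x b

/-- `X ⊆ [ℕ]^∞` is dominating. -/
def IsDominating (X : Set PN) : Prop := ∀ a ∈ InfSets, ∃ x ∈ X, LeStar a x

/-- The unbounding number `𝔟`: the minimal cardinality of an unbounded subset of `[ℕ]^∞`. -/
noncomputable def cardB : Cardinal.{0} :=
  sInf {κ | ∃ X : Set PN, X ⊆ InfSets ∧ ¬ IsBoundedStar X ∧ #X = κ}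

/-- The dominating number `𝔡`: the minimal cardinality of a dominating subset of `[ℕ]^∞`. -/
noncomputable def cardD : Cardinal.{0} :=
  sInf {κ | ∃ X : Set PN, X ⊆ InfSets ∧ IsDominating X ∧ #X = κ}

/-- A topological space with at least `κ` points is `κ`-concentrated if it has a countable subset
`D` such that fewer than `κ` points lie outside `U`, for every open set `U` containing `D`. -/
def IsConcentrated (κ : Cardinal.{u}) (Y : Type u) [TopologicalSpace Y] : Prop :=
  κ ≤ #Y ∧ ∃ D : Set Y, D.Countable ∧
    ∀ U : Set Y, IsOpen U → D ⊆ U → #(Uᶜ : Set Y) < κ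

/-- `𝒰` is an open cover of the space `X`. -/
def IsOpenCover {X : Type u} [TopologicalSpace X] (𝒰 : Set (Set X)) : Prop :=
  (∀ U ∈ 𝒰, IsOpen U) ∧ ⋃₀ 𝒰 = Set.univ

/-- Menger's property: for every sequence of open covers `𝒰 n` there are finite `ℱ n ⊆ 𝒰 n` whose
union covers the space. -/
def IsMenger (X : Type u) [TopologicalSpace X] : Prop :=
  ∀ 𝒰 : ℕ → Set (Set X), (∀ n, IsOpenCover (𝒰 n)) →
    ∃ ℱ : ℕ → Set (Set X), (∀ n, ℱ n ⊆ 𝒰 n ∧ (ℱ n).Finite) ∧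
      ⋃₀ (⋃ n, ℱ n) = Set.univ

/-- Hurewicz's property: for every sequence of open covers `𝒰 n` there are finite `ℱ n ⊆ 𝒰 n` such
that every point lies in `⋃₀ ℱ n` for all but finitely many `n`. -/
def IsHurewicz (X : Type u) [TopologicalSpace X] : Prop :=
  ∀ 𝒰 : ℕ → Set (Set X), (∀ n, IsOpenCover (𝒰 n)) →
    ∃ ℱ : ℕ → Set (Set X), (∀ n, ℱ n ⊆ 𝒰 n ∧ (ℱ n).Finite) ∧
      ∀ x : X, {n | x ∉ ⋃₀ (ℱ n)}.Finite

/-- In the realm of hereditarily Lindelöf spaces, the set of reals `X` is productively Menger. -/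
def ProductivelyMenger (X : Set ℝ) : Prop :=
  ∀ (Y : Type u) [TopologicalSpace Y], HereditarilyLindelofSpace Y → IsMenger Y →
    IsMenger (X × Y)

/-- In the realm of hereditarily Lindelöf spaces, the set of reals `X` is productively Hurewicz. -/
def ProductivelyHurewicz (X : Set ℝ) : Prop :=
  ∀ (Y : Type u) [TopologicalSpace Y], HereditarilyLindelofSpace Y → IsHurewicz Y →
    IsHurewicz (X × Y)

end MengerProd

/-! Under `𝔟 = 𝔡` there is a scale `d α`, `α < 𝔡`. Suppose an array of covers `O n m` of `Z` defeats
Hurewicz's property. For each `α` pick a point `z α` lying outside `O n (d α n)` for infinitely many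
`n`, and let `x α n` be the least `m` with `z α ∈ O n m`. Let `y α` be the orbit of `0` that jumps
from `k` to `x α k` when `d α k < x α k` and to `k + 1` otherwise. Its long jumps make the sets `y
α` concentrate on the finite sets, while the `n`-th landing point of a long jump exceeds `d α n`.
The closed relation "from each `k ∈ y`, the next element comes no later than `z` and `k` allow"
holds at every `(z α, y α)` and excludes finite `y`. On it the landing points form a dominating
family depending continuously on `y`, so `Z × Y` is not Menger
(`exists_isConcentrated_not_isMenger_prod`).

An unbounded `X` carries such an array, `{a | a(n) ≤ m}`, which gives the first claim. For the
second, a failure of Hurewicz for `X × H` gives `Y` with `(X × H) × Y` not Menger. But `H × Y` is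
Menger (`IsHurewicz.isMenger_prod`) and hereditarily Lindelöf, so `X × (H × Y)` is Menger, a
contradiction. -/

namespace MengerProd

open Filter

/-! ### Functions `ℕ → ℕ` and enumerations of infinite sets -/

/-- The range of `f : ℕ → ℕ`, as a point of the Cantor space. -/
noncomputable def rangeSet (f : ℕ → ℕ) : PN := fun k => open Classical in decide (∃ n, f n = k)

lemma rangeSet_mem_infSets {f : ℕ → ℕ} (hf : StrictMono f) : rangeSet f ∈ InfSets := by
  have : {n | rangeSet f n = true} = Set.range f := by ext; simp [rangeSet]
  simpa [InfSets, this] using Set.infinite_range_of_injective hf.injective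

lemma enum_rangeSet {f : ℕ → ℕ} (hf : StrictMono f) (n : ℕ) : enum (rangeSet f) n = f n := by
  have h := Nat.nth_comp_of_strictMono (n := n) (p := fun k => rangeSet f k = true) hf
    (fun k hk => by simpa [rangeSet] using hk)
    (fun hfi => absurd hfi (rangeSet_mem_infSets hf))
  rw [enum, ← h, Nat.nth_of_forall]
  intro k _
  simp [rangeSet]

lemma exists_strictMono_ge (f : ℕ → ℕ) : ∃ g : ℕ → ℕ, StrictMono g ∧ ∀ n, f n ≤ g n ∧ n < g n := by
  refine ⟨fun n => (∑ i ∈ Finset.range (n + 1), f i) + (n + 1), strictMono_nat_of_lt_succ ?_, ?_⟩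
  · intro n
    simp only [Finset.sum_range_succ _ (n + 1)]
    omega
  · intro n
    simp only [Finset.sum_range_succ _ n]
    omega

lemma leStar_iff {a b : PN} : LeStar a b ↔ ∀ᶠ n in atTop, enum a n ≤ enum b n := by
  rw [← Nat.cofinite_eq_atTop, eventually_cofinite]
  simp [LeStar]

lemma frequently_of_not_isBoundedStar {X : Set PN} (hX : ¬ IsBoundedStar X) (f : ℕ → ℕ) :
    ∃ x ∈ X, ∃ᶠ n in atTop, f n < enum x n := by
  obtain ⟨g, hg, hfg⟩ := exists_strictMono_ge f
  by_contra! h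
  refine hX ⟨rangeSet g, rangeSet_mem_infSets hg, fun x hx => leStar_iff.2 ?_⟩
  filter_upwards [h x hx] with n hn
  rw [enum_rangeSet hg]
  exact hn.trans (hfg n).1

/-- Fewer than `𝔟` functions have a common upper bound modulo finite. -/
lemma exists_bound_of_lt_cardB {ι : Type} (hι : #ι < cardB) (f : ι → ℕ → ℕ) :
    ∃ g : ℕ → ℕ, ∀ i, ∀ᶠ n in atTop, f i n ≤ g n := by
  choose F hF hfF using fun i => exists_strictMono_ge (f i)
  have hb : IsBoundedStar (Set.range fun i => rangeSet (F i)) := by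
    by_contra hb
    refine notMem_of_lt_csInf' (mk_range_le.trans_lt hι : #(Set.range fun i => rangeSet (F i)) < _)
      ⟨_, ?_, hb, rfl⟩
    rintro _ ⟨i, rfl⟩
    exact rangeSet_mem_infSets (hF i)
  obtain ⟨b, -, hb⟩ := hb
  refine ⟨enum b, fun i => ?_⟩
  filter_upwards [leStar_iff.1 (hb _ ⟨i, rfl⟩)] with n hn
  rw [enum_rangeSet (hF i)] at hn
  exact (hfF i n).1.trans hn

lemma cardD_le_of_isDominating {X : Set PN} (hX : X ⊆ InfSets) (h : IsDominating X) :
    cardD ≤ #X :=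
  csInf_le' ⟨X, hX, h, rfl⟩

lemma exists_isDominating_mk_eq : ∃ X : Set PN, X ⊆ InfSets ∧ IsDominating X ∧ #X = cardD :=
  csInf_mem (s := {κ | ∃ X : Set PN, X ⊆ InfSets ∧ IsDominating X ∧ #X = κ})
    ⟨_, InfSets, subset_rfl, fun a ha => ⟨a, ha, by simp [LeStar]⟩, rfl⟩

/-- If `𝔟 = 𝔡`, there is a family of length `𝔡` such that every function is bounded by all but
an initial segment of the family. -/
lemma exists_scale (hbd : cardB = cardD) :
    ∃ d : cardD.ord.ToType → ℕ → ℕ, (∀ i, StrictMono (d i) ∧ ∀ n, n < d i n) ∧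
      ∀ f : ℕ → ℕ, ∃ i, ∀ j, i ≤ j → ∀ᶠ n in atTop, f n ≤ d j n := by
  obtain ⟨X, hX, hdom, hcard⟩ := exists_isDominating_mk_eq
  obtain ⟨e⟩ : Nonempty (cardD.ord.ToType ≃ X) := Cardinal.eq.1 (by rw [mk_ord_toType, hcard])
  have hlt : ∀ j : cardD.ord.ToType, #(Set.Iio j) < cardB := fun j => by
    simpa [hbd] using mk_Iio_lt j
  -- Proper initial segments of the index set have size below `𝔡 = 𝔟`, so each stage can dominate
  -- all earlier members of the dominating family.
  have h1 : ∀ j, ∃ g : ℕ → ℕ, ∀ i : Set.Iio j, ∀ᶠ n in atTop, enum (e i) n ≤ g n := fun j =>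
    exists_bound_of_lt_cardB (hlt j) _
  choose g hg using h1
  choose d hd hgd using fun j => exists_strictMono_ge (fun n => max (g j n) (enum (e j) n))
  refine ⟨d, fun i => ⟨hd i, fun n => (hgd i n).2⟩, fun f => ?_⟩
  obtain ⟨F, hF, hfF⟩ := exists_strictMono_ge f
  obtain ⟨x, hx, hFx⟩ := hdom _ (rangeSet_mem_infSets hF)
  refine ⟨e.symm ⟨x, hx⟩, fun j hj => ?_⟩
  have hle : ∀ᶠ n in atTop, enum x n ≤ d j n := by
    rcases hj.lt_or_eq with hj | rfl
    · filter_upwards [hg j ⟨_, hj⟩] with n hn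
      simp only [Equiv.apply_symm_apply] at hn
      exact hn.trans ((le_max_left _ _).trans (hgd j n).1)
    · refine Eventually.of_forall fun n => ?_
      have := (hgd (e.symm ⟨x, hx⟩) n).1
      simp only [Equiv.apply_symm_apply] at this
      exact (le_max_right _ _).trans this
  filter_upwards [hle, leStar_iff.1 hFx] with n h1 h2
  rw [enum_rangeSet hF] at h2
  exact (hfF n).1.trans (h2.trans h1)

/-! ### Coverings indexed by functions -/

/-- A sequence of increasing countable open covers. -/
structure IsCoverArray {Z : Type u} [TopologicalSpace Z] (O : ℕ → ℕ → Set Z) : Prop where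
  isOpen : ∀ n m, IsOpen (O n m)
  mono : ∀ n, Monotone (O n)
  exists_mem : ∀ n z, ∃ m, z ∈ O n m

lemma exists_sUnion_subset_of_finite {Z : Type u} {O : ℕ → Set Z} (hO : Monotone O) {ℱ : Set (Set Z)}
    (hℱ : ℱ ⊆ Set.range O) (hfin : ℱ.Finite) : ∃ m, ⋃₀ ℱ ⊆ O m := by
  choose! e he using hℱ
  obtain ⟨m, hm⟩ := (hfin.image e).bddAbove
  refine ⟨m, Set.sUnion_subset fun U hU => ?_⟩
  rw [← he hU]
  exact hO (hm ⟨U, hU, rfl⟩)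

section Covers

variable {Z : Type u} [TopologicalSpace Z]

lemma IsCoverArray.isOpenCover {O : ℕ → ℕ → Set Z} (hO : IsCoverArray O) (n : ℕ) :
    IsOpenCover (Set.range (O n)) := by
  refine ⟨?_, Set.eq_univ_of_forall fun z => ?_⟩
  · rintro _ ⟨m, rfl⟩
    exact hO.isOpen n m
  · obtain ⟨m, hm⟩ := hO.exists_mem n z
    exact ⟨_, ⟨m, rfl⟩, hm⟩

lemma IsHurewicz.exists_fun (hZ : IsHurewicz Z) {O : ℕ → ℕ → Set Z} (hO : IsCoverArray O) :
    ∃ f : ℕ → ℕ, ∀ z, ∀ᶠ n in atTop, z ∈ O n (f n) := by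
  obtain ⟨ℱ, hℱ, hcov⟩ := hZ _ hO.isOpenCover
  choose f hf using fun n => exists_sUnion_subset_of_finite (hO.mono n) (hℱ n).1 (hℱ n).2
  refine ⟨f, fun z => ?_⟩
  have h : ∀ᶠ n in cofinite, z ∈ ⋃₀ ℱ n := hcov z
  rw [Nat.cofinite_eq_atTop] at h
  exact h.mono fun n hn => hf n hn

lemma IsMenger.exists_fun (hZ : IsMenger Z) {O : ℕ → ℕ → Set Z} (hO : IsCoverArray O) :
    ∃ f : ℕ → ℕ, ∀ z, ∃ n, z ∈ O n (f n) := by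
  obtain ⟨ℱ, hℱ, hcov⟩ := hZ _ hO.isOpenCover
  choose f hf using fun n => exists_sUnion_subset_of_finite (hO.mono n) (hℱ n).1 (hℱ n).2
  refine ⟨f, fun z => ?_⟩
  obtain ⟨U, hU, hz⟩ := hcov.ge (Set.mem_univ z)
  obtain ⟨n, hn⟩ := Set.mem_iUnion.1 hU
  exact ⟨n, hf n ⟨U, hn, hz⟩⟩

/-- Menger's property is applied to every tail of the sequence. The maximum over the tails starting
at `j ≤ n` is finite at each `n` and serves all of them. -/
lemma IsMenger.exists_fun_frequently (hZ : IsMenger Z) {O : ℕ → ℕ → Set Z}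
    (hO : IsCoverArray O) : ∃ f : ℕ → ℕ, ∀ z, ∃ᶠ n in atTop, z ∈ O n (f n) := by
  have hj : ∀ j, ∃ f : ℕ → ℕ, ∀ z, ∃ n, z ∈ O (n + j) (f n) := fun j =>
    hZ.exists_fun ⟨fun n => hO.isOpen (n + j), fun n => hO.mono (n + j),
      fun n => hO.exists_mem (n + j)⟩
  choose f hf using hj
  refine ⟨fun n => (Finset.range (n + 1)).sup fun j => f j (n - j), fun z => ?_⟩
  rw [frequently_atTop]
  intro j
  obtain ⟨n, hn⟩ := hf j z
  refine ⟨n + j, by omega, hO.mono _ ?_ hn⟩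
  have := Finset.le_sup (f := fun i => f i (n + j - i))
    (Finset.mem_range.2 (by omega : j < n + j + 1))
  simpa using this

lemma exists_isCoverArray [LindelofSpace Z] {𝒰 : ℕ → Set (Set Z)} (h : ∀ n, IsOpenCover (𝒰 n)) :
    ∃ O : ℕ → ℕ → Set Z, IsCoverArray O ∧ ∀ f : ℕ → ℕ, ∃ ℱ : ℕ → Set (Set Z),
      (∀ n, ℱ n ⊆ 𝒰 n ∧ (ℱ n).Finite) ∧ ∀ n, ⋃₀ (ℱ n) = O n (f n) := by
  have h1 : ∀ n, ∃ T ⊆ 𝒰 n, T.Countable ∧ ⋃₀ T = Set.univ := fun n => by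
    obtain ⟨T, hT, hTc, hcov⟩ := isLindelof_univ.elim_countable_subcover_image
      (b := 𝒰 n) (c := id) (h n).1 (by simpa only [id, ← Set.sUnion_eq_biUnion] using (h n).2.ge)
    exact ⟨T, hT, hTc, Set.eq_univ_of_univ_subset (by rwa [Set.sUnion_eq_biUnion])⟩
  choose T hT hTc hcov using h1
  choose e he using fun n => Set.countable_iff_exists_injOn.1 (hTc n)
  refine ⟨fun n m => ⋃₀ {U ∈ T n | e n U ≤ m}, ⟨fun n m => ?_, fun n m m' hm => ?_, fun n z => ?_⟩,
    fun f => ⟨fun n => {U ∈ T n | e n U ≤ f n}, fun n => ⟨fun U hU => hT n hU.1, ?_⟩, fun n => rfl⟩⟩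
  · exact isOpen_sUnion fun U hU => (h n).1 U (hT n hU.1)
  · exact Set.sUnion_subset_sUnion fun U hU => ⟨hU.1, hU.2.trans hm⟩
  · obtain ⟨U, hU, hz⟩ := (hcov n).ge (Set.mem_univ z)
    exact ⟨e n U, U, ⟨hU, le_rfl⟩, hz⟩
  · refine Set.Finite.of_finite_image ((Set.finite_Iic (f n)).subset ?_)
      ((he n).mono fun U hU => hU.1)
    rintro _ ⟨U, hU, rfl⟩
    exact hU.2

lemma isMenger_of_forall_isCoverArray [LindelofSpace Z]
    (h : ∀ O : ℕ → ℕ → Set Z, IsCoverArray O → ∃ f : ℕ → ℕ, ∀ z, ∃ n, z ∈ O n (f n)) :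
    IsMenger Z := by
  intro 𝒰 h𝒰
  obtain ⟨O, hO, hℱ⟩ := exists_isCoverArray h𝒰
  obtain ⟨f, hf⟩ := h O hO
  obtain ⟨ℱ, hℱ, hℱO⟩ := hℱ f
  refine ⟨ℱ, hℱ, Set.eq_univ_of_forall fun z => ?_⟩
  obtain ⟨n, hn⟩ := hf z
  rw [← hℱO] at hn
  exact Set.sUnion_subset_sUnion (Set.subset_iUnion ℱ n) hn

lemma isHurewicz_of_forall_isCoverArray [LindelofSpace Z]
    (h : ∀ O : ℕ → ℕ → Set Z, IsCoverArray O →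
      ∃ f : ℕ → ℕ, ∀ z, ∀ᶠ n in atTop, z ∈ O n (f n)) :
    IsHurewicz Z := by
  intro 𝒰 h𝒰
  obtain ⟨O, hO, hℱ⟩ := exists_isCoverArray h𝒰
  obtain ⟨f, hf⟩ := h O hO
  obtain ⟨ℱ, hℱ, hℱO⟩ := hℱ f
  refine ⟨ℱ, hℱ, fun z => ?_⟩
  have := hf z
  rw [← Nat.cofinite_eq_atTop] at this
  simpa only [hℱO] using eventually_cofinite.1 this

lemma IsMenger.of_continuous_surjective {W : Type u} [TopologicalSpace W] (hZ : IsMenger Z)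
    {g : Z → W} (hg : Continuous g) (hs : Function.Surjective g) : IsMenger W := by
  intro 𝒰 h𝒰
  obtain ⟨ℱ, hℱ, hcov⟩ := hZ (fun n => (fun U => g ⁻¹' U) '' 𝒰 n) fun n => by
    refine ⟨?_, Set.eq_univ_of_forall fun z => ?_⟩
    · rintro _ ⟨U, hU, rfl⟩
      exact ((h𝒰 n).1 U hU).preimage hg
    · obtain ⟨U, hU, hz⟩ := (h𝒰 n).2.ge (Set.mem_univ (g z))
      exact ⟨_, ⟨U, hU, rfl⟩, hz⟩
  choose 𝒢 h𝒢 h𝒢fin h𝒢eq using fun n => Set.exists_subset_image_finite_and.1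
    ⟨ℱ n, (hℱ n).1, (hℱ n).2, (rfl : ℱ n = ℱ n)⟩
  refine ⟨𝒢, fun n => ⟨h𝒢 n, h𝒢fin n⟩, Set.eq_univ_of_forall fun w => ?_⟩
  obtain ⟨z, rfl⟩ := hs w
  obtain ⟨V, hV, hz⟩ := hcov.ge (Set.mem_univ z)
  obtain ⟨n, hn⟩ := Set.mem_iUnion.1 hV
  rw [h𝒢eq n] at hn
  obtain ⟨U, hU, rfl⟩ := hn
  exact ⟨U, Set.mem_iUnion.2 ⟨n, hU⟩, hz⟩

end Covers

/-- The product of a hereditarily Lindelöf space and a second countable space is hereditarily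
Lindelöf. -/
lemma hereditarilyLindelofSpace_prod {A : Type*} {B : Type*} [TopologicalSpace A]
    [TopologicalSpace B] [HereditarilyLindelofSpace A] [SecondCountableTopology B] :
    HereditarilyLindelofSpace (A × B) := by
  refine ⟨fun s _ => isLindelof_of_countable_subcover fun {ι} U hU hs => ?_⟩
  -- `W b i` is the largest open `V` with `V ×ˢ b ⊆ U i`; for each of the countably many basic `b`,
  -- countably many `i` suffice.
  let W : Set B → ι → Set A := fun b i => ⋃₀ {V | IsOpen V ∧ V ×ˢ b ⊆ U i}
  have hW : ∀ b, ∃ t : Set ι, t.Countable ∧ ⋃ i ∈ t, W b i = ⋃ i, W b i := fun b =>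
    eq_open_union_countable (W b) fun i => isOpen_sUnion fun V hV => hV.1
  choose t htc ht using hW
  refine ⟨⋃ b ∈ TopologicalSpace.countableBasis B, t b,
    (TopologicalSpace.countable_countableBasis B).biUnion fun b _ => htc b, fun p hp => ?_⟩
  obtain ⟨i, hi⟩ := Set.mem_iUnion.1 (hs hp)
  obtain ⟨V, V', hV, hV', hpV, hpV', hsub⟩ := isOpen_prod_iff.1 (hU i) p.1 p.2 hi
  obtain ⟨b, hb, hpb, hbV'⟩ := (TopologicalSpace.isBasis_countableBasis B).exists_subset_of_mem_open
    hpV' hV'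
  have hmem : p.1 ∈ ⋃ i ∈ t b, W b i := by
    rw [ht b]
    exact Set.mem_iUnion.2 ⟨i, V, ⟨hV, (Set.prod_mono subset_rfl hbV').trans hsub⟩, hpV⟩
  simp only [Set.mem_iUnion] at hmem ⊢
  obtain ⟨j, hj, V₂, hV₂, hpV₂⟩ := hmem
  exact ⟨j, ⟨b, hb, hj⟩, hV₂.2 ⟨hpV₂, hpb⟩⟩

/-! ### A sparse set guided by two functions -/

/-- For `f` with `n < f n`: there is a set `y` containing `0` such that the successor in `y` of an
element `k` is `x k` if `f k < x k`, and is `k + 1` otherwise. -/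
lemma exists_sparse {f x : ℕ → ℕ} (hf : ∀ n, n < f n) (hx : ∃ᶠ n in atTop, f n < x n) :
    ∃ y : PN, y 0 = true ∧
      (∀ k, y k = true → f k < x k → y (x k) = true ∧ ∀ j, k < j → j < x k → y j = false) ∧
      (∀ k, y k = true → x k ≤ f k → y (k + 1) = true) ∧
      (∀ j, y (j + 1) = true → y j = false → ∃ k, y k = true ∧ f k < x k ∧ x k = j + 1) ∧
      ∃ᶠ k in atTop, y k = true ∧ f k < x k := by
  classical
  let step : ℕ → ℕ := fun k => if f k < x k then x k else k + 1
  have hstep : ∀ k, k < step k := fun k => by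
    have := hf k
    simp only [step]
    split_ifs <;> omega
  let s : ℕ → ℕ := fun n => step^[n] 0
  have hs : ∀ n, s (n + 1) = step (s n) := fun n => Function.iterate_succ_apply' _ _ _
  have hmono : StrictMono s := strictMono_nat_of_lt_succ fun n => by
    rw [hs]
    exact hstep _
  have hy : ∀ k, rangeSet s k = true ↔ ∃ n, s n = k := fun k => by simp [rangeSet]
  have hnext : ∀ k, rangeSet s k = true →
      rangeSet s (step k) = true ∧ ∀ j, k < j → j < step k → rangeSet s j = false := by
    intro k hk
    obtain ⟨n, rfl⟩ := (hy k).1 hk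
    refine ⟨(hy _).2 ⟨n + 1, hs n⟩, fun j h1 h2 => ?_⟩
    rw [← Bool.not_eq_true, hy]
    rintro ⟨m, rfl⟩
    rw [← hs] at h2
    have h1 := hmono.lt_iff_lt.1 h1
    have h2 := hmono.lt_iff_lt.1 h2
    omega
  refine ⟨rangeSet s, (hy 0).2 ⟨0, rfl⟩, fun k hk hlt => ?_, fun k hk hle => ?_,
    fun j hj1 hj => ?_, ?_⟩
  · simpa [step, hlt] using hnext k hk
  · simpa [step, hle.not_gt] using (hnext k hk).1
  · obtain ⟨n, hn⟩ := (hy _).1 hj1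
    rcases n with _ | n
    · simp [s] at hn
    · rw [hs] at hn
      refine ⟨s n, (hy _).2 ⟨n, rfl⟩, ?_⟩
      by_cases h : f (s n) < x (s n)
      · exact ⟨h, by simpa [step, h] using hn⟩
      · have : s n = j := by simpa [step, h] using hn
        rw [← Bool.not_eq_true, hy] at hj
        exact absurd ⟨n, this⟩ hj
  -- Without long jumps past stage `N` the orbit would advance by single steps and meet every later
  -- `k`, including one with `f k < x k`.
  · rw [frequently_atTop]
    intro N
    by_contra! h
    have hrun : ∀ i, s (N + i) = s N + i := by
      intro i
      induction i with
      | zero => rfl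
      | succ i ih =>
        have h1 := h (s (N + i)) ((by omega : N ≤ N + i).trans (hmono.id_le _))
          ((hy _).2 ⟨_, rfl⟩)
        rw [← Nat.add_assoc, hs]
        simp only [step, h1.not_gt, if_false]
        omega
    obtain ⟨k, hk, hlt⟩ := frequently_atTop.1 hx (s N)
    have h1 := h k ((hmono.id_le N).trans hk) ((hy k).2 ⟨N + (k - s N), by rw [hrun]; omega⟩)
    omega

/-- The elements of `y` other than `0` whose predecessor is not in `y`. -/
def gapEnds (y : PN) : PN := fun j => y j && (decide (j ≠ 0) && !y (j - 1))

lemma gapEnds_eq_true_iff {y : PN} {j : ℕ} :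
    gapEnds y j = true ↔ ∃ i, j = i + 1 ∧ y (i + 1) = true ∧ y i = false := by
  rcases j with _ | j <;> simp [gapEnds]

lemma gapEnds_mem_infSets {f x : ℕ → ℕ} (hf : ∀ n, n < f n) {y : PN}
    (h1 : ∀ k, y k = true → f k < x k → y (x k) = true ∧ ∀ j, k < j → j < x k → y j = false)
    (h2 : ∃ᶠ k in atTop, y k = true ∧ f k < x k) : gapEnds y ∈ InfSets := by
  refine Set.infinite_of_not_bddAbove fun ⟨b, hb⟩ => ?_
  obtain ⟨k, hk, hyk, hlt⟩ := frequently_atTop.1 h2 b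
  obtain ⟨h3, h4⟩ := h1 k hyk hlt
  have := hf k
  have h5 : gapEnds y (x k) = true :=
    gapEnds_eq_true_iff.2 ⟨x k - 1, by omega, by rwa [Nat.sub_add_cancel (by omega)],
      h4 _ (by omega) (by omega)⟩
  have h6 : x k ≤ b := hb h5
  omega

/-- A gap end `x k ≤ f n` satisfies `f k < f n`, so `k < n`; this leaves at most `n` candidates. -/
lemma count_gapEnds_le {f x : ℕ → ℕ} (hf : StrictMono f) {y : PN}
    (h : ∀ j, y (j + 1) = true → y j = false → ∃ k, y k = true ∧ f k < x k ∧ x k = j + 1) (n : ℕ) :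
    Nat.count (fun j => gapEnds y j = true) (f n + 1) ≤ n := by
  rw [Nat.count_eq_card_filter_range]
  have : (Finset.range (f n + 1)).filter (fun j => gapEnds y j = true) ⊆
      (Finset.range n).image x := by
    intro j hj
    rw [Finset.mem_filter, Finset.mem_range] at hj
    obtain ⟨i, rfl, h1, h2⟩ := gapEnds_eq_true_iff.1 hj.2
    obtain ⟨k, -, h3, h4⟩ := h i h1 h2
    exact Finset.mem_image.2 ⟨k, Finset.mem_range.2 (hf.lt_iff_lt.1 (by omega)), h4⟩
  exact (Finset.card_le_card this).trans (Finset.card_image_le.trans (by simp))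

lemma continuous_count_gapEnds (m : ℕ) :
    Continuous fun y : PN => Nat.count (fun j => gapEnds y j = true) m := by
  induction m with
  | zero => simpa using continuous_const
  | succ m ih =>
    simp only [Nat.count_succ]
    refine ih.add ?_
    have h : Continuous fun y : PN => gapEnds y m :=
      (continuous_of_discreteTopology (f := fun p : Bool × Bool =>
        p.1 && (decide (m ≠ 0) && !p.2))).comp
        (((continuous_apply m).prodMk (continuous_apply (m - 1)) :
          Continuous fun y : PN => (y m, y (m - 1))))
    exact (continuous_of_discreteTopology (f := fun b : Bool => if b = true then 1 else 0)).comp h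

/-! ### Concentration on the finite sets -/

/-- The family of finite subsets of `ℕ`. -/
def FinSets : Set PN := {a | {n | a n = true}.Finite}

lemma countable_finSets : FinSets.Countable := by
  refine Set.MapsTo.countable_of_injOn (f := fun a : PN => {n | a n = true})
    (t := {s : Set ℕ | s.Finite ∧ s ⊆ Set.univ}) (fun a ha => ⟨ha, Set.subset_univ _⟩) ?_
    (Set.countable_ofPred_finite_subset Set.countable_univ)
  intro a _ b _ h
  funext n
  rw [Bool.eq_iff_iff]
  simpa using Set.ext_iff.1 h n

/-- Every open set containing the finite sets contains every set with one sufficiently long gap. -/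
lemma exists_gap_bound {U : Set PN} (hU : IsOpen U) (hfin : FinSets ⊆ U) :
    ∃ b : ℕ → ℕ, ∀ (y : PN) (k : ℕ), (∀ j, k < j → j < b k → y j = false) → y ∈ U := by
  have h : ∀ k, ∃ b : ℕ, ∀ y : PN, (∀ j, k < j → j < b → y j = false) → y ∈ U := by
    intro k
    -- Each of the finitely many traces `p` on `{0, …, k}` extends by zeros to a finite set, whose
    -- basic neighbourhood in `U` restricts finitely many coordinates.
    have hcyl : ∀ p : Fin (k + 1) → Bool, ∃ b : ℕ, ∀ y : PN, (∀ i : Fin (k + 1), y i = p i) →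
        (∀ j, k < j → j < b → y j = false) → y ∈ U := by
      intro p
      let a : PN := fun j => if h : j ≤ k then p ⟨j, Nat.lt_succ_of_le h⟩ else false
      have ha : a ∈ U := hfin ((Set.finite_Iic k).subset fun j hj => by
        by_contra hjk
        have : ¬ j ≤ k := hjk
        simp [a, this] at hj)
      obtain ⟨I, u, hu, hsub⟩ := isOpen_pi_iff.1 hU a ha
      refine ⟨I.sup id + 1, fun y hy hgap => hsub fun j hj => ?_⟩
      have hja : y j = a j := by
        by_cases h : j ≤ k
        · simpa [a, h] using hy ⟨j, Nat.lt_succ_of_le h⟩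
        · have hjI : j ≤ I.sup id := Finset.le_sup (f := id) hj
          simpa [a, h] using hgap j (by omega) (by omega)
      rw [hja]
      exact (hu j hj).2
    choose b hb using hcyl
    refine ⟨Finset.univ.sup b, fun y hy => hb (fun i => y i) y (fun _ => rfl) fun j h1 h2 =>
      hy j h1 (h2.trans_le (Finset.le_sup (Finset.mem_univ _)))⟩
  choose b hb using h
  exact ⟨b, fun y k => hb k y⟩

/-! ### Non-Menger products with a concentrated set -/

/-- A non-Hurewicz array of covers of `Z` yields, when `𝔟 = 𝔡`, a `𝔡`-concentrated set whose product
with `Z` is not Menger. -/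
theorem exists_isConcentrated_not_isMenger_prod (hbd : cardB = cardD) {Z : Type u}
    [TopologicalSpace Z] {O : ℕ → ℕ → Set Z} (hO : IsCoverArray O)
    (hunb : ∀ f : ℕ → ℕ, ∃ z, ∃ᶠ n in atTop, z ∉ O n (f n)) :
    ∃ Y : Set PN, IsConcentrated cardD Y ∧ ¬ IsMenger (Z × Y) := by
  classical
  obtain ⟨d, hd, hscale⟩ := exists_scale hbd
  choose z hz using fun α => hunb (d α)
  let x : cardD.ord.ToType → ℕ → ℕ := fun α n => Nat.find (hO.exists_mem n (z α))
  have hx : ∀ α n m, z α ∈ O n m ↔ x α n ≤ m := fun α n m =>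
    ⟨fun h => Nat.find_min' _ h, fun h => hO.mono n h (Nat.find_spec (hO.exists_mem n (z α)))⟩
  have hdx : ∀ α, ∃ᶠ n in atTop, d α n < x α n := fun α =>
    (hz α).mono fun n hn => by rwa [hx, not_le] at hn
  choose y hy0 hybig hysmall hygap hyfreq using fun α => exists_sparse (hd α).2 (hdx α)
  have hG : ∀ α, gapEnds (y α) ∈ InfSets := fun α =>
    gapEnds_mem_infSets (hd α).2 (hybig α) (hyfreq α)
  have hcount : ∀ α n, Nat.count (fun j => gapEnds (y α) j = true) (d α n + 1) ≤ n := fun α =>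
    count_gapEnds_le (hd α).1 (hygap α)
  let Y : Set PN := FinSets ∪ Set.range y
  refine ⟨Y, ⟨?_, {p : Y | (p : PN) ∈ FinSets}, ?_, ?_⟩, ?_⟩
  -- The lower bound on `#Y` comes from an image of a subset of `Y` that is dominating.
  · have hdom : IsDominating (gapEnds '' Set.range y) := fun a ha => by
      obtain ⟨α, hα⟩ := hscale (enum a)
      refine ⟨_, ⟨_, ⟨α, rfl⟩, rfl⟩, leStar_iff.2 ?_⟩
      filter_upwards [hα α le_rfl] with n hn
      exact hn.trans ((Nat.le_succ _).trans
        ((Nat.count_le_iff_le_nth (hG α)).1 (hcount α n)))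
    refine (cardD_le_of_isDominating ?_ hdom).trans
      (mk_image_le.trans (mk_le_mk_of_subset Set.subset_union_right))
    rintro _ ⟨_, ⟨α, rfl⟩, rfl⟩
    exact hG α
  · exact countable_finSets.preimage Subtype.val_injective
  · intro U hU hsub
    obtain ⟨V, hV, rfl⟩ := isOpen_induced_iff.1 hU
    obtain ⟨b, hb⟩ := exists_gap_bound hV fun a ha => hsub (a := ⟨a, Or.inl ha⟩) ha
    obtain ⟨β, hβ⟩ := hscale b
    have hsmall : ((Subtype.val ⁻¹' V : Set Y)ᶜ) ⊆
        (fun α => ⟨y α, Or.inr ⟨α, rfl⟩⟩ : _ → Y) '' Set.Iio β := by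
      rintro ⟨p, hp⟩ hpV
      rcases hp with hp | ⟨α, rfl⟩
      · exact absurd (hsub (a := ⟨p, Or.inl hp⟩) hp) hpV
      · refine ⟨α, ?_, rfl⟩
        by_contra hα
        -- For `α ≥ β`, some long jump starts at a `k` with `b k ≤ d α k < x α k`, a gap long enough
        -- to force `y α ∈ V`.
        obtain ⟨k, ⟨hyk, hlt⟩, hbk⟩ :=
          ((hyfreq α).and_eventually (hβ α (not_lt.1 hα))).exists
        exact hpV (hb (y α) k fun j h1 h2 =>
          (hybig α k hyk hlt).2 j h1 (h2.trans_le (hbk.trans hlt.le)))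
    refine (mk_le_mk_of_subset hsmall).trans_lt (mk_image_le.trans_lt ?_)
    simpa using mk_Iio_lt β
  · intro hM
    -- The open complement of the relation. The bound `max m (k + 1)` accommodates both kinds of
    -- jump: to `x α k ≤ m` and to `k + 1`.
    let B : Set (Z × Y) := {p | (p.2 : PN) 0 = false} ∪ ⋃ (k : ℕ) (m : ℕ),
      {p | p.1 ∈ O k m ∧ (p.2 : PN) k = true ∧
        ∀ j ∈ Finset.Ioc k (max m (k + 1)), (p.2 : PN) j = false}
    have hval : ∀ j b, IsOpen {p : Z × Y | (p.2 : PN) j = b} := fun j b => by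
      have hc : Continuous fun p : Z × Y => (p.2 : PN) j :=
        (continuous_apply j).comp (continuous_subtype_val.comp continuous_snd)
      exact (isOpen_discrete {b}).preimage hc
    have hB : IsOpen B := by
      refine (hval 0 false).union (isOpen_iUnion fun k => isOpen_iUnion fun m =>
        ((hO.isOpen k m).preimage continuous_fst).inter ((hval k true).inter ?_))
      have : {p : Z × Y | ∀ j ∈ Finset.Ioc k (max m (k + 1)), (p.2 : PN) j = false} =
          ⋂ j ∈ Finset.Ioc k (max m (k + 1)), {p : Z × Y | (p.2 : PN) j = false} := by
        ext; simp
      have hopen := isOpen_biInter_finset (s := Finset.Ioc k (max m (k + 1)))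
        fun j _ => hval j false
      rwa [← this] at hopen
    have hBinf : ∀ p : Z × Y, p ∉ B → (p.2 : PN) ∉ FinSets := by
      intro p hp hfin
      obtain ⟨k, hk, hmax⟩ := Set.exists_max_image _ id hfin
        ⟨0, by_contra fun h => hp (Or.inl (by simpa using h))⟩
      obtain ⟨m, hm⟩ := hO.exists_mem k p.1
      refine hp (Or.inr (Set.mem_iUnion₂.2 ⟨k, m, hm, hk, fun j hj => ?_⟩))
      by_contra h
      have := hmax j (by simpa using h)
      have := (Finset.mem_Ioc.1 hj).1
      simp only [id] at *
      omega
    have hBy : ∀ α, (z α, (⟨y α, Or.inr ⟨α, rfl⟩⟩ : Y)) ∉ B := by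
      rintro α (h | h)
      · have h : y α 0 = false := h
        simp [hy0] at h
      · obtain ⟨k, m, hm, hk, hj⟩ := Set.mem_iUnion₂.1 h
        replace hm : x α k ≤ m := (hx _ _ _).1 hm
        replace hk : y α k = true := hk
        replace hj : ∀ j ∈ Finset.Ioc k (max m (k + 1)), y α j = false := hj
        rcases lt_or_ge (d α k) (x α k) with hlt | hle
        · have h1 := (hd α).2 k
          have h2 := hj (x α k) (Finset.mem_Ioc.2 ⟨by omega, by omega⟩)
          simp [(hybig α k hk hlt).1] at h2
        · have h2 := hj (k + 1) (Finset.mem_Ioc.2 ⟨by omega, by omega⟩)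
          simp [hysmall α k hk hle] at h2
    -- Outside `B` the second coordinate is some `y α`, whose infinitely many gap ends make the
    -- counts unbounded.
    have hP : IsCoverArray fun n m =>
        B ∪ {p | n < Nat.count (fun j => gapEnds (p.2 : PN) j = true) m} := by
      refine ⟨fun n m => hB.union ((isOpen_discrete (Set.Ioi n)).preimage
        ((continuous_count_gapEnds m).comp (continuous_subtype_val.comp continuous_snd))),
        fun n m m' hm => Set.union_subset_union_right _ fun p hp =>
          hp.trans_le (Nat.count_monotone _ hm), fun n p => ?_⟩
      by_cases hp : p ∈ B
      · exact ⟨0, Or.inl hp⟩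
      · obtain ⟨α, hα⟩ := p.2.2.resolve_left (hBinf p hp)
        obtain ⟨m, hm⟩ := Nat.surjective_count_of_infinite_setOfPred (hG α) (n + 1)
        refine ⟨m, Or.inr ?_⟩
        rw [hα] at hm
        exact (Nat.lt_succ_self n).trans_le hm.ge
    obtain ⟨g, hg⟩ := hM.exists_fun_frequently hP
    obtain ⟨α, hα⟩ := hscale g
    obtain ⟨n, hn, hgn⟩ := ((hg (z α, ⟨y α, Or.inr ⟨α, rfl⟩⟩)).and_eventually
      (hα α le_rfl)).exists
    rcases hn with hn | hn
    · exact hBy α hn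
    · have h1 : n < Nat.count (fun j => gapEnds (y α) j = true) (g n) := hn
      have h2 := Nat.count_monotone (fun j => gapEnds (y α) j = true)
        (hgn.trans (Nat.le_succ _))
      exact absurd (h1.trans_le (h2.trans (hcount α n))) (lt_irrefl n)

/-! ### Menger products of Hurewicz spaces with concentrated sets -/

/-- When `𝔟 = 𝔡`, the product of a Hurewicz hereditarily Lindelöf space and a `𝔡`-concentrated set
is Menger. -/
theorem IsHurewicz.isMenger_prod (hbd : cardB = cardD) {H : Type u} [TopologicalSpace H]
    [HereditarilyLindelofSpace H] (hH : IsHurewicz H) {Y : Set PN} (hY : IsConcentrated cardD Y) :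
    IsMenger (H × Y) := by
  have := hereditarilyLindelofSpace_prod (A := H) (B := Y)
  obtain ⟨hcard, D, hD, hDU⟩ := hY
  have hne : D.Nonempty := by
    rw [Set.nonempty_iff_ne_empty]
    rintro rfl
    have := hDU ∅ isOpen_empty subset_rfl
    rw [Set.compl_empty, mk_univ] at this
    exact absurd hcard this.not_ge
  obtain ⟨e, rfl⟩ := hD.exists_eq_range hne
  refine isMenger_of_forall_isCoverArray fun O hO => ?_
  -- Each point of `D` is listed infinitely often, so that every tail union `W j` below contains
  -- `D`.
  let c : ℕ → Y := fun n => e n.unpair.1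
  let cyl : Y → ℕ → Set Y := fun p m => {q | ∀ i ∈ Finset.range m, (q : PN) i = (p : PN) i}
  have hcyl : ∀ p m, IsOpen (cyl p m) := fun p m => by
    have : cyl p m = ⋂ i ∈ Finset.range m, {q : Y | (q : PN) i = (p : PN) i} := by
      ext; simp [cyl]
    rw [this]
    have hc : ∀ i, Continuous fun q : Y => (q : PN) i := fun i =>
      (continuous_apply i).comp continuous_subtype_val
    exact isOpen_biInter_finset fun i _ => (isOpen_discrete {(p : PN) i}).preimage (hc i)
  have hcyl_anti : ∀ p m m', m ≤ m' → cyl p m' ⊆ cyl p m := fun p m m' h q hq i hi =>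
    hq i (Finset.mem_range.2 ((Finset.mem_range.1 hi).trans_le h))
  have hcyl_basis : ∀ p (U : Set Y), IsOpen U → p ∈ U → ∃ m, cyl p m ⊆ U := by
    intro p U hU hp
    obtain ⟨V, hV, rfl⟩ := isOpen_induced_iff.1 hU
    obtain ⟨I, u, hu, hsub⟩ := isOpen_pi_iff.1 hV p hp
    refine ⟨I.sup id + 1, fun q hq => hsub fun i hi => ?_⟩
    rw [hq i (Finset.mem_range.2 (Nat.lt_succ_of_le (Finset.le_sup (f := id) hi)))]
    exact (hu i hi).2
  obtain ⟨f, hf⟩ := hH.exists_fun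
    (O := fun n m => ⋃₀ {V | IsOpen V ∧ V ×ˢ cyl (c n) m ⊆ O n m}) ⟨fun n m =>
      isOpen_sUnion fun V hV => hV.1, fun n m m' hm => Set.sUnion_subset_sUnion fun V hV =>
      ⟨hV.1, (Set.prod_mono subset_rfl (hcyl_anti _ _ _ hm)).trans (hV.2.trans (hO.mono n hm))⟩,
      fun n h => by
        obtain ⟨m, hm⟩ := hO.exists_mem n (h, c n)
        obtain ⟨V, W, hV, hW, hhV, hcW, hsub⟩ := isOpen_prod_iff.1 (hO.isOpen n m) _ _ hm
        obtain ⟨m', hm'⟩ := hcyl_basis _ W hW hcW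
        exact ⟨max m m', V, ⟨hV, (Set.prod_mono subset_rfl ((hcyl_anti _ _ _
          (le_max_right _ _)).trans hm')).trans (hsub.trans (hO.mono n (le_max_left _ _)))⟩, hhV⟩⟩
  let W : ℕ → Set Y := fun j => ⋃ n ≥ j, cyl (c n) (f n)
  have hW : ∀ j, #((W j)ᶜ : Set Y) < cardB := fun j => hbd ▸ hDU (W j)
    (isOpen_biUnion fun n _ => hcyl _ _) (by
      rintro _ ⟨i, rfl⟩
      refine Set.mem_iUnion₂.2 ⟨Nat.pair i j, Nat.right_le_pair i j, ?_⟩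
      simp [cyl, c])
  choose g hg using fun q : Y => hH.exists_fun (O := fun n m => {h | (h, q) ∈ O n m}) ⟨fun n m =>
    (hO.isOpen n m).preimage (Continuous.prodMk_left q), fun n m m' hm h hh => hO.mono n hm hh,
    fun n h => hO.exists_mem n (h, q)⟩
  choose b hb using fun j => exists_bound_of_lt_cardB (hW j) fun q => g q
  -- Points in every `W j` are caught by the tubes around `D`. A point outside some `W j` is one of
  -- fewer than `𝔟`, whose slices are jointly bounded by `b j`; the supremum over `j ≤ n` eventually
  -- includes it.
  refine ⟨fun n => max (f n) ((Finset.range (n + 1)).sup fun j => b j n), fun ⟨h, q⟩ => ?_⟩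
  by_cases hq : ∀ j, q ∈ W j
  · obtain ⟨j, hj⟩ := eventually_atTop.1 (hf h)
    obtain ⟨n, hn, hqn⟩ := Set.mem_iUnion₂.1 (hq j)
    obtain ⟨V, hV, hhV⟩ := hj n hn
    exact ⟨n, hO.mono n (le_max_left _ _) (hV.2 ⟨hhV, hqn⟩)⟩
  · push Not at hq
    obtain ⟨j, hj⟩ := hq
    obtain ⟨n, ⟨hn1, hn2⟩, hn3⟩ :=
      (((hg q h).and (hb j ⟨q, hj⟩)).and (eventually_ge_atTop j)).exists
    refine ⟨n, hO.mono n (hn2.trans ((Finset.le_sup (f := fun j => b j n)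
      (Finset.mem_range.2 (Nat.lt_succ_of_le hn3))).trans (le_max_right _ _))) hn1⟩

/-- The condition `a(n) ≤ m` says that `a` has more than `n` elements below `m + 1`, which depends
on finitely many coordinates. -/
lemma isCoverArray_enum {X : Set PN} (hX : X ⊆ InfSets) :
    IsCoverArray fun n m => {a : X | enum a n ≤ m} := by
  refine ⟨fun n m => ?_, fun n m m' hm a ha => le_trans ha hm, fun n a => ⟨enum a n, le_refl (enum a n)⟩⟩
  have hcont : ∀ k, Continuous fun a : PN => Nat.count (fun j => a j = true) k := by
    intro k
    induction k with
    | zero => simpa using continuous_const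
    | succ k ih =>
      simp only [Nat.count_succ]
      exact ih.add ((continuous_of_discreteTopology
        (f := fun b : Bool => if b = true then 1 else 0)).comp (continuous_apply k))
  have : {a : X | enum a n ≤ m} =
      (fun a : X => Nat.count (fun j => (a : PN) j = true) (m + 1)) ⁻¹' Set.Ioi n := by
    ext a
    have h2 := Nat.count_le_iff_le_nth (hX a.2) (a := m + 1) (b := n)
    simp only [Set.mem_ofPred_eq, Set.mem_preimage, Set.mem_Ioi, enum]
    rw [← not_lt, ← Nat.succ_le_iff, ← h2, not_le]
  rw [this]
  exact (isOpen_discrete _).preimage ((hcont _).comp continuous_subtype_val)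

end MengerProd

theorem mainTheorem4 (hbd : MengerProd.cardB = MengerProd.cardD) :
    (∀ X : Set MengerProd.PN, X ⊆ MengerProd.InfSets → ¬ MengerProd.IsBoundedStar X →
      ∃ Y : Set MengerProd.PN,
        MengerProd.IsConcentrated MengerProd.cardD Y ∧ ¬ MengerProd.IsMenger (X × Y)) ∧
    (∀ X : Set ℝ, MengerProd.ProductivelyMenger.{u} X →
      MengerProd.ProductivelyHurewicz.{u} X) := by
  refine ⟨fun X hX hunb => ?_, fun X hX H _ hH hHur => ?_⟩
  · refine MengerProd.exists_isConcentrated_not_isMenger_prod hbd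
      (MengerProd.isCoverArray_enum hX) fun f => ?_
    obtain ⟨x, hx, hfx⟩ := MengerProd.frequently_of_not_isBoundedStar hunb f
    exact ⟨⟨x, hx⟩, hfx.mono fun n hn => not_le.2 hn⟩
  -- The second countable factor must stand on the right, hence the swap afterwards.
  · have : HereditarilyLindelofSpace (H × X) := MengerProd.hereditarilyLindelofSpace_prod
    have : LindelofSpace (X × H) := LindelofSpace.of_continuous_surjective
      continuous_swap Prod.swap_surjective
    refine MengerProd.isHurewicz_of_forall_isCoverArray fun O hO => ?_
    by_contra! hunb
    obtain ⟨Y, hY, hM⟩ := MengerProd.exists_isConcentrated_not_isMenger_prod hbd hO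
      fun f => by simpa using hunb f
    refine hM ((hX (H × Y) MengerProd.hereditarilyLindelofSpace_prod
      (hHur.isMenger_prod hbd hY)).of_continuous_surjective
        (Homeomorph.prodAssoc X H Y).symm.continuous (Homeomorph.prodAssoc X H Y).symm.surjective)
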